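/- Let $n_c>0$, $\mathfrak F>0$, let $\eta\ge 0$ be an integer, and let $f^*$ be a real- or complex-valued function on $[0,\infty)$ such that 1. $f^*$ is $C^\infty$ on $[0,\infty)\setminus\{\mathfrak F\}$ (one-sided at $0$); 2. at the junction point, $f^*$ is $\eta$ times continuously differentiable in a neighbourhood of $\mathfrak F$, and $(f^*)^{(\eta+1)}$ is bounded on a punctured neighbourhood of $\mathfrak F$; 3. $f^*$ decays fast at infinity: for every $0\le k\le \eta+1$, $(f^*)^{(k)}(x)=O\big(e^{-(\eta+1)x/(2n_c)}\big)$ as $x\to\infty$ (this holds, for instance, if $f^*$ and its derivatives up to order $\eta+1$ decay faster than every exponential, as a Gaussian does). Define $K(r)=f^*(x)$ with $x=-n_c\log\left(\frac{1+\cos r}{2}\right)$ for $r\in[0,\pi)$, $K(\pi)=\lim_{x\to\infty}f^*(x)$, and extend $K$ to $\mathbb R$ as an even $2\pi$-periodic function. For $n\ge 1$ let $$V_n[K](r)=\frac{2}{n\pi}\sum_{\ell=n}^{2n-1}\sum_{j=0}^{\ell}\alpha_j\cos(jr)\int_0^\pi K(\tau)\cos(j\tau)\,d\tau,\qquad \alpha_0=\tfrac12,\quad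 \alpha_j=1\ (j\ge1),$$ be its de la Vallée-Poussin (VP) sum. Then there is a constant $C$, independent of $n$ and $r$, such that $$\left|V_n[K](r)-K(r)\right|\le C\,n^{-\eta-1}\qquad\text{for all } n\ge 1 \text{ and all } r\in\mathbb R.$$ -/

import Mathlib

open scoped ContDiff Topology

noncomputable section

/-- The function `K` obtained from `f : [0, ∞) → 𝕜` by the change of variables
`x = -n_c log ((1 + cos r) / 2)`, extended evenly and `2π`-periodically from `[0, π]` to the line.
The right-hand side depends on `r` only through `cos r`, so this formula is the even periodic
extension. At the odd multiples of `π`, which correspond to `x = +∞`, the value is the limit of `f`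
at infinity. -/
def transformedKernel {𝕜 : Type*} [RCLike 𝕜] (nc : ℝ) (f : ℝ → 𝕜) (r : ℝ) : 𝕜 :=
  open Classical in
  if Real.cos r = -1 then Filter.limUnder Filter.atTop f
  else f (-nc * Real.log ((1 + Real.cos r) / 2))

/-- The de la Vallée-Poussin sum
`V_n[K](r) = 2/(nπ) ∑_{ℓ=n}^{2n-1} ∑_{j=0}^{ℓ} α_j cos (j r) ∫_0^π K(τ) cos (j τ) dτ`,
with `α_0 = 1/2` and `α_j = 1` for `j ≥ 1`. -/
def vpSum {𝕜 : Type*} [RCLike 𝕜] (n : ℕ) (K : ℝ → 𝕜) (r : ℝ) : 𝕜 :=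
  (2 / ((n : ℝ) * Real.pi)) •
    ∑ l ∈ Finset.Icc n (2 * n - 1), ∑ j ∈ Finset.range (l + 1),
      ((if j = 0 then (1 / 2 : ℝ) else 1) * Real.cos ((j : ℝ) * r)) •
        ∫ τ in (0 : ℝ)..Real.pi, Real.cos ((j : ℝ) * τ) • K τ

theorem transformedKernel_neg {𝕜 : Type*} [RCLike 𝕜] (nc : ℝ) (f : ℝ → 𝕜) (r : ℝ) :
    transformedKernel nc f (-r) = transformedKernel nc f r := by
  simp [transformedKernel]

theorem transformedKernel_periodic {𝕜 : Type*} [RCLike 𝕜] (nc : ℝ) (f : ℝ → 𝕜) :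
    Function.Periodic (transformedKernel nc f) (2 * Real.pi) := by
  intro r
  simp [transformedKernel]

theorem transformedKernel_of_mem {𝕜 : Type*} [RCLike 𝕜] (nc : ℝ) (f : ℝ → 𝕜) (r : ℝ)
    (hr : r ∈ Set.Ico 0 Real.pi) :
    transformedKernel nc f r = f (-nc * Real.log ((1 + Real.cos r) / 2)) := by
  have h : Real.cos Real.pi < Real.cos r :=
    Real.cos_lt_cos_of_nonneg_of_le_pi hr.1 le_rfl hr.2
  rw [Real.cos_pi] at h
  simp [transformedKernel, h.ne']

theorem transformedKernel_pi {𝕜 : Type*} [RCLike 𝕜] (nc : ℝ) (f : ℝ → 𝕜) (L : 𝕜)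
    (hL : Filter.Tendsto f Filter.atTop (𝓝 L)) :
    transformedKernel nc f Real.pi = L := by
  simp [transformedKernel, hL.limUnder_eq]

end

/-! Two independent facts combine: `K` has Lipschitz `η`-th derivative, and VP sums approximate such
functions to order `n^{-η-1}`.

Approximation. The VP kernel has `L¹` norm at most 3 (`integral_abs_vpKernel_le`), and `V_n` fixes
the trigonometric polynomials of degree at most `n` that arise by smoothing
(`periodicConv_vpKernel_periodicConv`). Take a nonnegative cosine polynomial `J` of degree at most
`n`, of mass 1 and first absolute moment `O(1/n)` (`exists_jackson_kernel`). Since `V_n (J∗g) =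
J∗g`, the error of `V_n` at `g` equals its error at `g - J∗g`. Each such replacement trades one
order of differences of `g` for a factor `O(1/n)` (`DiffBound.sub_periodicConv`); after `η + 1` of
them only `‖V_n‖ + 1 ≤ 4` remains.

Regularity. The delicate points are the odd multiples of `π`, where `x = ∞`. As `dx/dr = n_c tan
(r/2)`, the `m`-th derivative of `K` is a combination of `f^(k)(x)`, `k ≤ m`, with coefficients
polynomial of degree at most `m` in `tan (r/2)`. The decay rate is exactly `exp (-(η+1)x/(2n_c)) =
|cos (r/2)|^(η+1)`, so that `K^(m) = O(|cos (r/2)|^(η+1-m))`: the derivatives up to order `η` extend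
by 0 to these points, and the one of order `η + 1` is bounded off a countable set
(`diffBound_transformedKernel`). -/

noncomputable section VPKernel

open Real intervalIntegral

/-! ### Dirichlet and Fejér kernels, and moments of the squared Fejér kernel -/

/-- The `l`-th partial sum of `1/2 + cos t + cos 2t + ⋯`. -/
def dirichletSum (l : ℕ) (t : ℝ) : ℝ :=
  ∑ j ∈ Finset.range (l + 1), (if j = 0 then (1 / 2 : ℝ) else 1) * cos (j * t)

/-- The squared modulus of `∑_{k<N} exp(ikt)`. -/
def fejerSq (N : ℕ) (t : ℝ) : ℝ :=
  (∑ k ∈ Finset.range N, cos (k * t)) ^ 2 + (∑ k ∈ Finset.range N, sin (k * t)) ^ 2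

theorem fejerSq_nonneg (N : ℕ) (t : ℝ) : 0 ≤ fejerSq N t := by
  unfold fejerSq; positivity

@[fun_prop]
theorem continuous_fejerSq (N : ℕ) : Continuous (fejerSq N) := by
  unfold fejerSq; fun_prop

@[fun_prop]
theorem continuous_dirichletSum (N : ℕ) : Continuous (dirichletSum N) := by
  unfold dirichletSum; fun_prop

theorem fejerSq_eq (N : ℕ) (t : ℝ) :
    fejerSq N t = 2 * ∑ l ∈ Finset.range N, dirichletSum l t := by
  induction N with
  | zero => simp [fejerSq]
  | succ N ih =>
    rw [Finset.sum_range_succ, mul_add, ← ih]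
    have h1 : dirichletSum N t
        = 1 / 2 + ∑ k ∈ Finset.range N, cos ((N : ℝ) * t - k * t) := by
      unfold dirichletSum
      rw [Finset.sum_range_succ', add_comm, ← Finset.sum_range_reflect]
      simp only [if_true, Nat.cast_zero, zero_mul, cos_zero, mul_one]
      congr 1
      refine Finset.sum_congr rfl fun k hk => ?_
      have hk := Finset.mem_range.1 hk
      rw [if_neg (by omega), one_mul]
      have : ((N - 1 - k + 1 : ℕ) : ℝ) = N - k := by
        rw [← Nat.cast_sub hk.le]; congr 1; omega
      rw [this, sub_mul]
    rw [h1]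
    simp only [cos_sub, Finset.sum_add_distrib, ← Finset.mul_sum]
    unfold fejerSq
    rw [Finset.sum_range_succ, Finset.sum_range_succ]
    nlinarith [sin_sq_add_cos_sq ((N : ℝ) * t)]

theorem fejerSq_le (N : ℕ) (t : ℝ) : fejerSq N t ≤ 2 * (N : ℝ) ^ 2 := by
  have h1 : |∑ k ∈ Finset.range N, cos (k * t)| ≤ N := by
    refine (Finset.abs_sum_le_sum_abs _ _).trans ?_
    refine (Finset.sum_le_sum fun k _ => abs_cos_le_one _).trans (by simp)
  have h2 : |∑ k ∈ Finset.range N, sin (k * t)| ≤ N := by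
    refine (Finset.abs_sum_le_sum_abs _ _).trans ?_
    refine (Finset.sum_le_sum fun k _ => abs_sin_le_one _).trans (by simp)
  have h3 := sq_le_sq' (abs_le.1 h1).1 (abs_le.1 h1).2
  have h4 := sq_le_sq' (abs_le.1 h2).1 (abs_le.1 h2).2
  unfold fejerSq; linarith

theorem two_sin_mul_sum_cos (N : ℕ) (t : ℝ) :
    2 * sin (t / 2) * ∑ k ∈ Finset.range N, cos (k * t)
      = sin ((N : ℝ) * t - t / 2) + sin (t / 2) := by
  induction N with
  | zero => simp
  | succ N ih =>
    rw [Finset.sum_range_succ, mul_add, ih]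
    have : ((N + 1 : ℕ) : ℝ) * t - t / 2 = N * t + t / 2 := by push_cast; ring
    rw [this, sin_add, sin_sub]; ring

theorem two_sin_mul_sum_sin (N : ℕ) (t : ℝ) :
    2 * sin (t / 2) * ∑ k ∈ Finset.range N, sin (k * t)
      = cos (t / 2) - cos ((N : ℝ) * t - t / 2) := by
  induction N with
  | zero => simp
  | succ N ih =>
    rw [Finset.sum_range_succ, mul_add, ih]
    have : ((N + 1 : ℕ) : ℝ) * t - t / 2 = N * t + t / 2 := by push_cast; ring
    rw [this, cos_add, cos_sub]; ring

/-- Summing the geometric series bounds `sin² (t/2)` times the kernel, and Jordan's inequality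
compares `sin (t/2)` with `t/π`. The constants are not sharp. -/
theorem fejerSq_mul_sq_le (N : ℕ) {t : ℝ} (ht : |t| ≤ π) : fejerSq N t * t ^ 2 ≤ 20 := by
  have h1 : sin (t / 2) ^ 2 * fejerSq N t ≤ 2 := by
    have hc := two_sin_mul_sum_cos N t
    have hs := two_sin_mul_sum_sin N t
    have : 4 * (sin (t / 2) ^ 2 * fejerSq N t)
        = (sin ((N : ℝ) * t - t / 2) + sin (t / 2)) ^ 2
          + (cos (t / 2) - cos ((N : ℝ) * t - t / 2)) ^ 2 := by
      rw [← hc, ← hs, fejerSq]; ring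
    nlinarith [sin_sq_add_cos_sq (t / 2), sin_sq_add_cos_sq ((N : ℝ) * t - t / 2),
      sq_nonneg (sin ((N : ℝ) * t - t / 2) - sin (t / 2)),
      sq_nonneg (cos ((N : ℝ) * t - t / 2) + cos (t / 2))]
  have h2 : |t| / π ≤ |sin (t / 2)| := by
    have h := mul_abs_le_abs_sin (x := t / 2) (by rw [abs_div, abs_two]; linarith)
    rw [abs_div, abs_two] at h
    calc |t| / π = 2 / π * (|t| / 2) := by ring
      _ ≤ _ := h
  have h3 : t ^ 2 ≤ π ^ 2 * sin (t / 2) ^ 2 := by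
    rw [div_le_iff₀ pi_pos] at h2
    have := pow_le_pow_left₀ (abs_nonneg t) h2 2
    rw [sq_abs, mul_pow, sq_abs] at this; linarith
  have h4 : π ^ 2 ≤ 10 := by nlinarith [pi_lt_d2, pi_pos]
  calc fejerSq N t * t ^ 2 ≤ fejerSq N t * (π ^ 2 * sin (t / 2) ^ 2) :=
        mul_le_mul_of_nonneg_left h3 (fejerSq_nonneg N t)
    _ = π ^ 2 * (sin (t / 2) ^ 2 * fejerSq N t) := by ring
    _ ≤ 10 * 2 := mul_le_mul h4 h1 (mul_nonneg (sq_nonneg _) (fejerSq_nonneg N t)) (by norm_num)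
    _ = 20 := by norm_num

/-- The bounds `2N²` and `20/t²` in one integrable majorant, `22 = 2 + 20`. -/
theorem fejerSq_mul_le {N : ℕ} {t : ℝ} (ht : |t| ≤ π) :
    fejerSq N t ≤ 22 * (N : ℝ) ^ 2 * (1 + (N * t) ^ 2)⁻¹ := by
  rw [← div_eq_mul_inv, le_div_iff₀ (by positivity)]
  nlinarith [fejerSq_le N t, mul_le_mul_of_nonneg_left (fejerSq_mul_sq_le N ht) (sq_nonneg (N : ℝ))]

theorem le_fejerSq {N : ℕ} (hN : 1 ≤ N) {t : ℝ} (h0 : 0 ≤ t) (ht : t ≤ 1 / N) :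
    (N : ℝ) ^ 2 / 4 ≤ fejerSq N t := by
  have hN' : (0 : ℝ) < N := by exact_mod_cast hN
  have h : (N : ℝ) / 2 ≤ ∑ k ∈ Finset.range N, cos (k * t) := by
    have : ∑ k ∈ Finset.range N, (1 / 2 : ℝ) ≤ ∑ k ∈ Finset.range N, cos (k * t) := by
      refine Finset.sum_le_sum fun k hk => ?_
      have hk : (k : ℝ) ≤ N := by exact_mod_cast (Finset.mem_range.1 hk).le
      have h1 : (k : ℝ) * t ≤ 1 := by
        calc (k : ℝ) * t ≤ N * (1 / N) := by gcongr
          _ = 1 := by field_simp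
      have h2 : 0 ≤ (k : ℝ) * t := by positivity
      nlinarith [one_sub_sq_div_two_le_cos (x := (k : ℝ) * t)]
    simpa [div_eq_mul_inv] using this
  have := pow_le_pow_left₀ (by positivity) h 2
  unfold fejerSq
  nlinarith [sq_nonneg (∑ k ∈ Finset.range N, sin (k * t))]

/-- The interval `[0, 1/N]` alone gives this: there every `cos (kt)` is at least `1/2`, so the
kernel is at least `N²/4`. -/
theorem integral_fejerSq_sq_ge {N : ℕ} (hN : 1 ≤ N) :
    (N : ℝ) ^ 3 / 16 ≤ ∫ t in (-π)..π, fejerSq N t ^ 2 := by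
  have hN' : (0 : ℝ) < N := by exact_mod_cast hN
  have hN1 : 1 / (N : ℝ) ≤ 1 := by
    rw [div_le_one hN']; exact_mod_cast hN
  have hc : Continuous fun t => fejerSq N t ^ 2 := by fun_prop
  calc (N : ℝ) ^ 3 / 16 = ∫ t in (0 : ℝ)..1 / N, (N : ℝ) ^ 4 / 16 := by
        simp; field_simp
    _ ≤ ∫ t in (0 : ℝ)..1 / N, fejerSq N t ^ 2 := by
        refine integral_mono_on (by positivity) (by simp) (hc.intervalIntegrable _ _) ?_
        intro t ht
        have := pow_le_pow_left₀ (by positivity) (le_fejerSq hN ht.1 ht.2) 2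
        calc _ = _ := by ring
          _ ≤ _ := this
    _ ≤ ∫ t in (-π)..π, fejerSq N t ^ 2 := by
        refine integral_mono_interval (by linarith [pi_pos]) (by positivity)
          (by linarith [pi_gt_three]) ?_ (hc.intervalIntegrable _ _)
        exact Filter.Eventually.of_forall fun t => sq_nonneg _

/-- One factor `(1 + (Nt)²)⁻¹` of the squared majorant absorbs `N|t|`; the other integrates to
`π/N`. Here `484 = 22²`. -/
theorem integral_abs_mul_fejerSq_sq_le {N : ℕ} (hN : 1 ≤ N) :
    ∫ t in (-π)..π, |t| * fejerSq N t ^ 2 ≤ 484 * π * (N : ℝ) ^ 2 := by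
  have hN' : (0 : ℝ) < N := by exact_mod_cast hN
  have hint : MeasureTheory.Integrable fun t : ℝ => (1 + (N * t) ^ 2)⁻¹ :=
    integrable_inv_one_add_sq.comp_mul_left' hN'.ne'
  have hcont : Continuous fun t : ℝ => |t| * fejerSq N t ^ 2 := by fun_prop
  calc ∫ t in (-π)..π, |t| * fejerSq N t ^ 2
      ≤ ∫ t in (-π)..π, 484 * (N : ℝ) ^ 3 * (1 + (N * t) ^ 2)⁻¹ := by
        refine integral_mono_on (by linarith [pi_pos]) (hcont.intervalIntegrable _ _)
          ((hint.const_mul _).intervalIntegrable) ?_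
        intro t ht
        have h1 := fejerSq_mul_le (N := N) (abs_le.2 ⟨ht.1, ht.2⟩)
        have h2 := pow_le_pow_left₀ (fejerSq_nonneg N t) h1 2
        have h3 : N * |t| ≤ 1 + (N * t) ^ 2 := by
          have : (N * t) ^ 2 = (N * |t|) ^ 2 := by rw [mul_pow, mul_pow, sq_abs]
          rw [this]; nlinarith [sq_nonneg (N * |t| - 1)]
        calc |t| * fejerSq N t ^ 2
            ≤ |t| * (22 * (N : ℝ) ^ 2 * (1 + (N * t) ^ 2)⁻¹) ^ 2 := by gcongr
          _ = 484 * (N : ℝ) ^ 3 * (1 + (N * t) ^ 2)⁻¹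
              * ((N * |t|) * (1 + (N * t) ^ 2)⁻¹) := by ring
          _ ≤ 484 * (N : ℝ) ^ 3 * (1 + (N * t) ^ 2)⁻¹ * 1 := by
              gcongr
              rw [← div_eq_mul_inv, div_le_one (by positivity)]; exact h3
          _ = _ := mul_one _
    _ = 484 * (N : ℝ) ^ 3 * ∫ t in (-π)..π, (1 + (N * t) ^ 2)⁻¹ := by
        rw [integral_const_mul]
    _ ≤ 484 * (N : ℝ) ^ 3 * ∫ t : ℝ, (1 + (N * t) ^ 2)⁻¹ := by
        gcongr
        rw [integral_of_le (by linarith [pi_pos])]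
        exact MeasureTheory.setIntegral_le_integral hint
          (Filter.Eventually.of_forall fun t => by positivity)
    _ = 484 * π * (N : ℝ) ^ 2 := by
        rw [MeasureTheory.Measure.integral_comp_mul_left (fun y : ℝ => (1 + y ^ 2)⁻¹),
          integral_univ_inv_one_add_sq, abs_of_pos (by positivity)]
        simp only [smul_eq_mul]; field_simp

/-! ### Cosine polynomials and the VP kernel -/

/-- Real combinations of `cos (j t)`, `j ≤ d`. -/
def cosSpan (d : ℕ) : Submodule ℝ (ℝ → ℝ) :=
  Submodule.span ℝ ((fun (j : ℕ) (t : ℝ) => cos (j * t)) '' Set.Iic d)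

theorem cos_mem_cosSpan {j d : ℕ} (h : j ≤ d) : (fun t : ℝ => cos (j * t)) ∈ cosSpan d :=
  Submodule.subset_span ⟨j, h, rfl⟩

theorem cosSpan_mono {d e : ℕ} (h : d ≤ e) : cosSpan d ≤ cosSpan e :=
  Submodule.span_mono (Set.image_mono (Set.Iic_subset_Iic.2 h))

theorem mul_mem_cosSpan {d e : ℕ} {u v : ℝ → ℝ} (hu : u ∈ cosSpan d) (hv : v ∈ cosSpan e) :
    u * v ∈ cosSpan (d + e) := by
  have h : cosSpan d * cosSpan e ≤ cosSpan (d + e) := by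
    clear hu hv
    rw [cosSpan, cosSpan, Submodule.span_mul_span, Submodule.span_le]
    rintro _ ⟨_, ⟨j, hj, rfl⟩, _, ⟨k, hk, rfl⟩, rfl⟩
    simp only [Set.mem_Iic] at hj hk
    wlog hjk : k ≤ j generalizing j k d e
    · have := this (d := e) (e := d) k j hk hj (le_of_not_ge hjk)
      rw [add_comm d e]
      simpa [mul_comm] using this
    have heq : ((fun t : ℝ => cos (j * t)) * fun t : ℝ => cos (k * t))
        = (1 / 2 : ℝ) • (fun t : ℝ => cos ((j + k : ℕ) * t))
          + (1 / 2 : ℝ) • (fun t : ℝ => cos ((j - k : ℕ) * t)) := by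
      ext t
      simp only [Pi.mul_apply, Pi.add_apply, Pi.smul_apply, smul_eq_mul]
      rw [Nat.cast_sub hjk, Nat.cast_add, add_mul, sub_mul, cos_add, cos_sub]; ring
    simp only [SetLike.mem_coe]
    rw [heq]
    exact add_mem (Submodule.smul_mem _ _ (cos_mem_cosSpan (by omega)))
      (Submodule.smul_mem _ _ (cos_mem_cosSpan (by omega)))
  exact h (Submodule.mul_mem_mul hu hv)

theorem dirichletSum_mem (l : ℕ) : dirichletSum l ∈ cosSpan l := by
  have : dirichletSum l = ∑ j ∈ Finset.range (l + 1),
      (if j = 0 then (1 / 2 : ℝ) else 1) • fun t : ℝ => cos (j * t) := by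
    ext t; simp only [dirichletSum, Finset.sum_apply, Pi.smul_apply, smul_eq_mul]
  rw [this]
  exact sum_mem fun j hj => Submodule.smul_mem _ _
    (cos_mem_cosSpan (Nat.lt_succ_iff.1 (Finset.mem_range.1 hj)))

theorem fejerSq_mem (N : ℕ) : fejerSq N ∈ cosSpan (N - 1) := by
  have : fejerSq N = (2 : ℝ) • ∑ l ∈ Finset.range N, dirichletSum l := by
    ext t; simp [fejerSq_eq]
  rw [this]
  refine Submodule.smul_mem _ _ (sum_mem fun l hl => ?_)
  exact cosSpan_mono (by have := Finset.mem_range.1 hl; omega) (dirichletSum_mem l)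

theorem integral_cos_nat_mul {j : ℕ} (hj : j ≠ 0) : ∫ t in (-π)..π, cos (j * t) = 0 := by
  have : (j : ℝ) ≠ 0 := by exact_mod_cast hj
  rw [integral_comp_mul_left (fun x => cos x) this, integral_cos]
  simp [sin_nat_mul_pi]

theorem integral_cos_mul_cos (i j : ℕ) :
    ∫ t in (-π)..π, cos (j * t) * cos (i * t)
      = if i = j then (if j = 0 then 2 * π else π) else 0 := by
  wlog hij : i ≤ j generalizing i j
  · have := this j i (le_of_not_ge hij)
    simp only [mul_comm (cos ((j : ℝ) * _))]
    rw [this]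
    by_cases h : i = j
    · subst h; rfl
    · rw [if_neg h, if_neg (Ne.symm h)]
  have heq : ∀ t : ℝ, cos (j * t) * cos (i * t)
      = (1 / 2 : ℝ) * cos ((j + i : ℕ) * t) + (1 / 2 : ℝ) * cos ((j - i : ℕ) * t) := by
    intro t
    rw [Nat.cast_sub hij, Nat.cast_add, add_mul, sub_mul, cos_add, cos_sub]; ring
  simp only [heq]
  have hc : ∀ k : ℕ, Continuous fun t : ℝ => (1 / 2 : ℝ) * cos (k * t) := fun k => by fun_prop
  rw [integral_add ((hc _).intervalIntegrable _ _) ((hc _).intervalIntegrable _ _),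
    integral_const_mul, integral_const_mul]
  rcases eq_or_ne i j with rfl | hne
  · rcases eq_or_ne i 0 with rfl | h0
    · simp; ring
    · rw [integral_cos_nat_mul (by omega : i + i ≠ 0)]; simp [h0]; ring
  · rw [integral_cos_nat_mul (by omega : j + i ≠ 0), integral_cos_nat_mul (by omega : j - i ≠ 0)]
    simp [hne]

theorem integral_dirichletSum_mul_cos {i l : ℕ} (h : i ≤ l) :
    ∫ t in (-π)..π, dirichletSum l t * cos (i * t) = π := by
  simp only [dirichletSum, Finset.sum_mul, mul_assoc]
  rw [integral_finsetSum fun j _ => Continuous.intervalIntegrable (by fun_prop) _ _]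
  simp only [integral_const_mul, integral_cos_mul_cos]
  rw [Finset.sum_eq_single_of_mem i (Finset.mem_range.2 (by omega))]
  · by_cases h0 : i = 0 <;> simp [h0]
  · intro b _ hb; simp [hb.symm]

/-- The kernel of the de la Vallée-Poussin sum. -/
def vpKernel (n : ℕ) (t : ℝ) : ℝ :=
  1 / (n * π) * ∑ l ∈ Finset.Icc n (2 * n - 1), dirichletSum l t

@[fun_prop]
theorem continuous_vpKernel (n : ℕ) : Continuous (vpKernel n) := by
  unfold vpKernel; fun_prop

theorem vpKernel_neg (n : ℕ) (t : ℝ) : vpKernel n (-t) = vpKernel n t := by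
  simp [vpKernel, dirichletSum]

/-- All `n` Dirichlet sums in the average have order at least `n ≥ i`, so each contains frequency
`i` with full weight. This is why `V_n` reproduces degree `n`. -/
theorem integral_vpKernel_mul_cos {n i : ℕ} (hn : 1 ≤ n) (hi : i ≤ n) :
    ∫ t in (-π)..π, vpKernel n t * cos (i * t) = 1 := by
  have hn' : (n : ℝ) ≠ 0 := by positivity
  simp only [vpKernel, mul_assoc, Finset.sum_mul]
  rw [integral_const_mul,
    integral_finsetSum fun j _ => Continuous.intervalIntegrable (by fun_prop) _ _,
    Finset.sum_congr rfl fun l hl =>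
      integral_dirichletSum_mul_cos (hi.trans (Finset.mem_Icc.1 hl).1)]
  rw [Finset.sum_const, Nat.card_Icc, show 2 * n - 1 + 1 - n = n by omega, nsmul_eq_mul]
  field_simp

theorem integral_neg_of_odd {E : Type*} [NormedAddCommGroup E] [NormedSpace ℝ E] {u : ℝ → E}
    (h : ∀ t, u (-t) = -u t) (a : ℝ) : ∫ t in (-a)..a, u t = 0 := by
  have h1 := integral_comp_neg (a := -a) (b := a) u
  simp only [h, neg_neg, integral_neg] at h1
  have h2 : (2 : ℝ) • ∫ t in (-a)..a, u t = 0 := by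
    rw [two_smul]; nth_rewrite 1 [← h1]; simp
  exact (smul_eq_zero.1 h2).resolve_left two_ne_zero

theorem integral_vpKernel_mul_sin (n i : ℕ) :
    ∫ t in (-π)..π, vpKernel n t * sin (i * t) = 0 :=
  integral_neg_of_odd (fun t => by rw [vpKernel_neg, mul_neg, sin_neg, mul_neg]) π

/-- The kernel is a difference of two nonnegative Fejér kernels, `(F_{2n} - F_n)/(2nπ)`, of masses
`4nπ` and `2nπ` before normalisation. -/
theorem integral_abs_vpKernel_le {n : ℕ} (hn : 1 ≤ n) : ∫ t in (-π)..π, |vpKernel n t| ≤ 3 := by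
  have hn' : (0 : ℝ) < n := by exact_mod_cast hn
  have hF : ∀ N, ∫ t in (-π)..π, fejerSq N t = 2 * N * π := by
    intro N
    simp only [fejerSq_eq]
    rw [integral_const_mul,
      integral_finsetSum fun j _ => Continuous.intervalIntegrable (by fun_prop) _ _]
    have : ∀ l, ∫ t in (-π)..π, dirichletSum l t = π := fun l => by
      simpa using integral_dirichletSum_mul_cos (Nat.zero_le l)
    simp [this]; ring
  have hv : ∀ t, vpKernel n t = 1 / (2 * n * π) * (fejerSq (2 * n) t - fejerSq n t) := by
    intro t
    rw [fejerSq_eq, fejerSq_eq, vpKernel, ← mul_sub,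
      ← Finset.sum_range_add_sum_Ico _ (show n ≤ 2 * n by omega), add_sub_cancel_left]
    have : Finset.Icc n (2 * n - 1) = Finset.Ico n (2 * n) := by
      ext l; simp only [Finset.mem_Icc, Finset.mem_Ico]; omega
    rw [this]; field_simp
  have hle : ∀ t, |vpKernel n t| ≤ 1 / (2 * n * π) * (fejerSq (2 * n) t + fejerSq n t) := by
    intro t
    rw [hv, abs_mul, abs_of_pos (by positivity)]
    gcongr
    rw [abs_le]
    constructor <;> linarith [fejerSq_nonneg (2 * n) t, fejerSq_nonneg n t]
  calc ∫ t in (-π)..π, |vpKernel n t|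
      ≤ ∫ t in (-π)..π, 1 / (2 * n * π) * (fejerSq (2 * n) t + fejerSq n t) :=
        integral_mono_on (by linarith [pi_pos]) (Continuous.intervalIntegrable (by fun_prop) _ _)
          (Continuous.intervalIntegrable (by fun_prop) _ _) fun t _ => hle t
    _ = 3 := by
        rw [integral_const_mul, integral_add (Continuous.intervalIntegrable (by fun_prop) _ _)
          (Continuous.intervalIntegrable (by fun_prop) _ _), hF, hF]
        push_cast; field_simp; norm_num

end VPKernel

/-! ### Periodic correlation and reproduction of trigonometric polynomials -/

noncomputable section PeriodicConv

open Real intervalIntegral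

variable {𝕜 : Type*} [RCLike 𝕜]

/-- The correlation over a period of a function `g` with a scalar kernel `J`. -/
def periodicConv (J : ℝ → ℝ) (g : ℝ → 𝕜) (r : ℝ) : 𝕜 :=
  ∫ t in (-π)..π, J t • g (r + t)

theorem continuous_periodicConv {J : ℝ → ℝ} {g : ℝ → 𝕜} (hJ : Continuous J) (hg : Continuous g) :
    Continuous (periodicConv J g) :=
  continuous_parametric_intervalIntegral_of_continuous'
    (f := fun r t => J t • g (r + t)) (by simp only [Function.uncurry_def]; fun_prop) _ _

theorem periodic_periodicConv (J : ℝ → ℝ) {g : ℝ → 𝕜} (hg : Function.Periodic g (2 * π)) :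
    Function.Periodic (periodicConv J g) (2 * π) := by
  intro r
  unfold periodicConv
  congr 1; ext t
  rw [add_right_comm, hg]

theorem periodicConv_sub_right {J : ℝ → ℝ} {g h : ℝ → 𝕜} (hJ : Continuous J) (hg : Continuous g)
    (hh : Continuous h) (r : ℝ) :
    periodicConv J (fun x => g x - h x) r = periodicConv J g r - periodicConv J h r := by
  unfold periodicConv
  rw [← integral_sub (Continuous.intervalIntegrable (by fun_prop) _ _)
    (Continuous.intervalIntegrable (by fun_prop) _ _)]
  simp only [smul_sub]

theorem norm_periodicConv_le {J : ℝ → ℝ} (hJ : Continuous J) {g : ℝ → 𝕜} (hg : Continuous g)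
    {L : ℝ} (hL : ∀ r, ‖g r‖ ≤ L) (r : ℝ) :
    ‖periodicConv J g r‖ ≤ (∫ t in (-π)..π, |J t|) * L := by
  rw [← integral_mul_const]
  refine (norm_integral_le_integral_norm (by linarith [pi_pos])).trans ?_
  refine integral_mono_on (by linarith [pi_pos]) (Continuous.intervalIntegrable (by fun_prop) _ _)
    (Continuous.intervalIntegrable (by fun_prop) _ _) fun t _ => ?_
  rw [norm_smul, norm_eq_abs]
  exact mul_le_mul_of_nonneg_left (hL _) (abs_nonneg _)

theorem periodicConv_cos {g : ℝ → 𝕜} (hg : Continuous g) (hp : Function.Periodic g (2 * π))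
    (j : ℕ) (r : ℝ) :
    periodicConv (fun t => cos (j * t)) g r
      = cos (j * r) • (∫ t in (-π)..π, cos (j * t) • g t)
        + sin (j * r) • (∫ t in (-π)..π, sin (j * t) • g t) := by
  have hper : Function.Periodic (fun t => cos (j * (t - r)) • g t) (2 * π) := by
    intro t
    simp only [hp t]
    rw [show (j : ℝ) * (t + 2 * π - r) = j * (t - r) + j * (2 * π) by ring, cos_add_nat_mul_two_pi]
  calc periodicConv (fun t => cos (j * t)) g r
      = ∫ t in (-π)..π, (fun t => cos (j * (t - r)) • g t) (r + t) := by
        simp [periodicConv]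
    _ = ∫ t in (r + -π)..(r + -π) + 2 * π, cos (j * (t - r)) • g t := by
        rw [integral_comp_add_left (fun t => cos (j * (t - r)) • g t)]
        congr 1; ring
    _ = ∫ t in (-π)..(-π) + 2 * π, cos (j * (t - r)) • g t := hper.intervalIntegral_add_eq _ _
    _ = ∫ t in (-π)..π, (cos (j * r) • cos (j * t) • g t + sin (j * r) • sin (j * t) • g t) := by
        rw [show -π + 2 * π = π by ring]
        congr 1; ext t
        rw [smul_smul, smul_smul, ← add_smul, mul_sub, cos_sub]
        congr 1; ring
    _ = _ := by
        rw [integral_add (Continuous.intervalIntegrable (by fun_prop) _ _)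
          (Continuous.intervalIntegrable (by fun_prop) _ _), integral_smul, integral_smul]

theorem periodicConv_vpKernel_periodicConv_cos {g : ℝ → 𝕜} (hg : Continuous g)
    (hp : Function.Periodic g (2 * π)) {n j : ℕ} (hn : 1 ≤ n) (hj : j ≤ n) (r : ℝ) :
    periodicConv (vpKernel n) (periodicConv (fun t => cos (j * t)) g) r
      = periodicConv (fun t => cos (j * t)) g r := by
  rw [periodicConv]
  simp only [periodicConv_cos hg hp]
  set a := ∫ t in (-π)..π, cos (j * t) • g t
  set b := ∫ t in (-π)..π, sin (j * t) • g t
  have heq : ∀ t, vpKernel n t • (cos (j * (r + t)) • a + sin (j * (r + t)) • b)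
      = (vpKernel n t * cos (j * t)) • (cos (j * r) • a + sin (j * r) • b)
        + (vpKernel n t * sin (j * t)) • (cos (j * r) • b - sin (j * r) • a) := by
    intro t
    rw [mul_add, cos_add, sin_add]
    module
  simp only [heq]
  rw [integral_add (Continuous.intervalIntegrable (by fun_prop) _ _)
    (Continuous.intervalIntegrable (by fun_prop) _ _), intervalIntegral.integral_smul_const,
    intervalIntegral.integral_smul_const, integral_vpKernel_mul_cos hn hj,
    integral_vpKernel_mul_sin, one_smul, zero_smul, add_zero]

theorem continuous_of_mem_cosSpan {d : ℕ} {J : ℝ → ℝ} (hJ : J ∈ cosSpan d) : Continuous J := by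
  induction hJ using Submodule.span_induction with
  | mem x hx => obtain ⟨j, -, rfl⟩ := hx; fun_prop
  | zero => exact continuous_zero
  | add x y _ _ hx hy => exact hx.add hy
  | smul a x _ hx => exact hx.const_smul a

theorem periodicConv_add_left {J J' : ℝ → ℝ} {g : ℝ → 𝕜} (hJ : Continuous J)
    (hJ' : Continuous J') (hg : Continuous g) :
    periodicConv (J + J') g = periodicConv J g + periodicConv J' g := by
  ext r
  simp only [periodicConv, Pi.add_apply, add_smul]
  exact integral_add (Continuous.intervalIntegrable (by fun_prop) _ _)
    (Continuous.intervalIntegrable (by fun_prop) _ _)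

theorem periodicConv_smul_left (a : ℝ) (J : ℝ → ℝ) (g : ℝ → 𝕜) :
    periodicConv (a • J) g = a • periodicConv J g := by
  ext r
  simp only [periodicConv, Pi.smul_apply, smul_assoc]
  exact integral_smul _ _

/-- Smoothing by a cosine polynomial of degree at most `n` yields a trigonometric polynomial of that
degree, and by linearity a single frequency suffices. -/
theorem periodicConv_vpKernel_periodicConv {g : ℝ → 𝕜} (hg : Continuous g)
    (hp : Function.Periodic g (2 * π)) {n : ℕ} (hn : 1 ≤ n) {J : ℝ → ℝ} (hJ : J ∈ cosSpan n) :
    periodicConv (vpKernel n) (periodicConv J g) = periodicConv J g := by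
  induction hJ using Submodule.span_induction with
  | mem x hx =>
    obtain ⟨j, hj, rfl⟩ := hx
    exact funext (periodicConv_vpKernel_periodicConv_cos hg hp hn hj)
  | zero => ext r; simp [periodicConv]
  | add x y hx hy ihx ihy =>
    have hx := continuous_of_mem_cosSpan hx
    have hy := continuous_of_mem_cosSpan hy
    have cx := continuous_periodicConv hx hg
    have cy := continuous_periodicConv hy hg
    rw [periodicConv_add_left hx hy hg]
    nth_rewrite 2 [← ihx, ← ihy]
    ext r
    simp only [periodicConv.eq_1 (vpKernel n), Pi.add_apply, smul_add]
    exact integral_add (Continuous.intervalIntegrable (by fun_prop) _ _)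
      (Continuous.intervalIntegrable (by fun_prop) _ _)
  | smul a x _ ih =>
    rw [periodicConv_smul_left]
    nth_rewrite 2 [← ih]
    ext r
    simp only [periodicConv.eq_1 (vpKernel n), Pi.smul_apply, smul_comm _ a]
    exact integral_smul _ _

/-- Evenness kills the sine coefficients and doubles the half-period integrals, which accounts for
`2/(nπ)` against the `1/(nπ)` of the kernel. -/
theorem vpSum_eq_periodicConv {g : ℝ → 𝕜} (hg : Continuous g) (hp : Function.Periodic g (2 * π))
    (he : ∀ r, g (-r) = g r) (n : ℕ) (r : ℝ) :
    vpSum n g r = periodicConv (vpKernel n) g r := by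
  have hcos : ∀ j : ℕ, periodicConv (fun t => cos (j * t)) g r
      = (2 : ℝ) • cos (j * r) • ∫ t in (0 : ℝ)..π, cos (j * t) • g t := by
    intro j
    rw [periodicConv_cos hg hp, integral_neg_of_odd (u := fun t => sin (j * t) • g t)
      (fun t => by rw [he, mul_neg, sin_neg, neg_smul]), smul_zero, add_zero, smul_comm]
    congr 1
    have hc : Continuous fun t => cos (j * t) • g t := by fun_prop
    rw [← integral_add_adjacent_intervals (hc.intervalIntegrable (-π) 0)
      (hc.intervalIntegrable 0 π), two_smul]
    congr 1
    have := integral_comp_neg (a := -π) (b := 0) fun t => cos (j * t) • g t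
    simpa [he] using this
  have hv : vpKernel n
      = (1 / (n * π) : ℝ) • ∑ l ∈ Finset.Icc n (2 * n - 1), dirichletSum l := by
    ext t; simp only [vpKernel, Finset.sum_apply, Pi.smul_apply, smul_eq_mul]
  have hd : ∀ l, dirichletSum l = ∑ j ∈ Finset.range (l + 1),
      (if j = 0 then (1 / 2 : ℝ) else 1) • fun t : ℝ => cos (j * t) := by
    intro l
    ext t; simp only [dirichletSum, Finset.sum_apply, Pi.smul_apply, smul_eq_mul]
  have hsum : ∀ (s : Finset ℕ) (J : ℕ → ℝ → ℝ), (∀ i, Continuous (J i)) →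
      periodicConv (∑ i ∈ s, J i) g = ∑ i ∈ s, periodicConv (J i) g := by
    intro s J hJ
    ext x
    simp only [periodicConv, Finset.sum_apply, Finset.sum_smul]
    exact integral_finsetSum fun i _ => Continuous.intervalIntegrable (by fun_prop) _ _
  rw [hv, periodicConv_smul_left, hsum _ _ continuous_dirichletSum]
  simp only [Pi.smul_apply, Finset.sum_apply, hd]
  simp_rw [hsum _ _ fun j => (by fun_prop : Continuous
    ((if j = 0 then (1 / 2 : ℝ) else 1) • fun t : ℝ => cos (j * t)))]
  simp only [Finset.sum_apply, periodicConv_smul_left, Pi.smul_apply, hcos, vpSum,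
    Finset.smul_sum]
  refine Finset.sum_congr rfl fun l _ => Finset.sum_congr rfl fun j _ => ?_
  simp only [smul_smul]
  congr 1
  ring

/-! ### Finite differences and Jackson's estimate -/

/-- All `m`-fold differences of `g` with steps `t₁, …, t_m` are bounded by `L |t₁ ⋯ t_m|`. -/
def DiffBound : ℕ → ℝ → (ℝ → 𝕜) → Prop
  | 0, L, g => ∀ r, ‖g r‖ ≤ L
  | m + 1, L, g => ∀ t, DiffBound m (L * |t|) fun r => g (r + t) - g r

/-- As `J` has mass 1, `g - J∗g` is minus the `J`-average of the differences `g(· + t) - g`, each of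
size `L|t|`. Higher orders follow because differencing commutes with smoothing. -/
theorem DiffBound.sub_periodicConv {J : ℝ → ℝ} (hJ : Continuous J) (h0 : ∀ t, 0 ≤ J t)
    (h1 : ∫ t in (-π)..π, J t = 1) {m : ℕ} {L : ℝ} {g : ℝ → 𝕜} (hg : Continuous g)
    (h : DiffBound (m + 1) L g) :
    DiffBound m ((∫ t in (-π)..π, |t| * J t) * L) fun r => g r - periodicConv J g r := by
  induction m generalizing L g with
  | zero =>
    intro r
    have heq : g r - periodicConv J g r = -∫ t in (-π)..π, J t • (g (r + t) - g r) := by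
      simp only [smul_sub]
      rw [integral_sub (Continuous.intervalIntegrable (by fun_prop) _ _)
        (Continuous.intervalIntegrable (by fun_prop) _ _), intervalIntegral.integral_smul_const,
        h1, one_smul, neg_sub, periodicConv]
    simp only [heq]
    rw [norm_neg, ← integral_mul_const]
    refine (norm_integral_le_integral_norm (by linarith [pi_pos])).trans ?_
    refine integral_mono_on (by linarith [pi_pos])
      (Continuous.intervalIntegrable (by fun_prop) _ _)
      (Continuous.intervalIntegrable (by fun_prop) _ _) fun t _ => ?_
    rw [norm_smul, norm_eq_abs, abs_of_nonneg (h0 t)]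
    calc J t * ‖g (r + t) - g r‖ ≤ J t * (L * |t|) := mul_le_mul_of_nonneg_left (h t r) (h0 t)
      _ = _ := by ring
  | succ m ih =>
    intro s
    have hc : Continuous fun r => g (r + s) := by fun_prop
    have := ih (g := fun r => g (r + s) - g r) (by fun_prop) (h s)
    rw [mul_assoc]
    convert this using 2 with r
    rw [periodicConv_sub_right hJ hc hg]
    have : periodicConv J (fun r => g (r + s)) r = periodicConv J g (r + s) := by
      unfold periodicConv
      congr 1; ext t; rw [add_right_comm]
    rw [this]; ring

/-- Induction on `m`, replacing `g` by `g - J∗g`, which has the same VP error. The constant is `4 =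
3 + 1`. -/
theorem norm_periodicConv_vpKernel_sub_le {n : ℕ} (hn : 1 ≤ n) {J : ℝ → ℝ} (hJ : J ∈ cosSpan n)
    (h0 : ∀ t, 0 ≤ J t) (h1 : ∫ t in (-π)..π, J t = 1) {m : ℕ} {L : ℝ} {g : ℝ → 𝕜}
    (hg : Continuous g) (hp : Function.Periodic g (2 * π)) (h : DiffBound m L g) (r : ℝ) :
    ‖periodicConv (vpKernel n) g r - g r‖ ≤ 4 * ((∫ t in (-π)..π, |t| * J t) ^ m * L) := by
  have hJc := continuous_of_mem_cosSpan hJ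
  induction m generalizing L g with
  | zero =>
    have h2 := norm_periodicConv_le (continuous_vpKernel n) hg h r
    have hL : 0 ≤ L := (norm_nonneg _).trans (h 0)
    calc _ ≤ ‖periodicConv (vpKernel n) g r‖ + ‖g r‖ := norm_sub_le _ _
      _ ≤ 3 * L + L := add_le_add (h2.trans (by gcongr; exact integral_abs_vpKernel_le hn)) (h r)
      _ = _ := by ring
  | succ m ih =>
    have hA := continuous_periodicConv hJc hg
    have := ih (hg.sub hA) (hp.sub (periodic_periodicConv J hp)) (h.sub_periodicConv hJc h0 h1 hg)
    rw [show g - periodicConv J g = fun x => g x - periodicConv J g x from rfl] at this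
    rw [periodicConv_sub_right (continuous_vpKernel n) hg hA,
      periodicConv_vpKernel_periodicConv hg hp hn hJ] at this
    calc _ = _ := by rw [sub_sub_sub_cancel_right]
      _ ≤ _ := this
      _ = _ := by ring

theorem exists_jackson_kernel {n : ℕ} (hn : 1 ≤ n) : ∃ J ∈ cosSpan n, (∀ t, 0 ≤ J t) ∧
    ∫ t in (-π)..π, J t = 1 ∧ ∫ t in (-π)..π, |t| * J t ≤ 50000 / n := by
  -- The largest `N` for which the squared Fejér kernel, of degree `2(N - 1)`, stays within degree
  -- `n`.
  set N := n / 2 + 1 with hNdef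
  have hN : 1 ≤ N := by omega
  have hN' : (0 : ℝ) < N := by exact_mod_cast hN
  have hn' : (0 : ℝ) < n := by exact_mod_cast hn
  have hNn : (n : ℝ) ≤ 2 * N := by exact_mod_cast (by omega : n ≤ 2 * N)
  set I := ∫ t in (-π)..π, fejerSq N t ^ 2
  have hI : (N : ℝ) ^ 3 / 16 ≤ I := integral_fejerSq_sq_ge hN
  have hI0 : 0 < I := lt_of_lt_of_le (by positivity) hI
  refine ⟨I⁻¹ • (fejerSq N * fejerSq N), ?_, fun t => ?_, ?_, ?_⟩
  · exact Submodule.smul_mem _ _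
      (cosSpan_mono (by omega) (mul_mem_cosSpan (fejerSq_mem N) (fejerSq_mem N)))
  · exact mul_nonneg (inv_nonneg.2 hI0.le) (mul_self_nonneg _)
  · simp only [Pi.smul_apply, smul_eq_mul, ← sq]
    rw [integral_const_mul]
    exact inv_mul_cancel₀ hI0.ne'
  · simp only [Pi.smul_apply, smul_eq_mul, ← sq, mul_left_comm _ I⁻¹]
    rw [integral_const_mul]
    calc I⁻¹ * ∫ t in (-π)..π, |t| * fejerSq N t ^ 2
        ≤ ((N : ℝ) ^ 3 / 16)⁻¹ * (484 * π * (N : ℝ) ^ 2) := by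
          refine mul_le_mul (inv_anti₀ (by positivity) hI) (integral_abs_mul_fejerSq_sq_le hN) ?_
            (by positivity)
          exact integral_nonneg (by linarith [pi_pos]) fun t _ => by positivity
      -- `7744 = 16 · 484`; then `n ≤ 2N` and `π < 3.15` give `2 · 7744 π < 50000`.
      _ = 7744 * π / N := by field_simp; norm_num
      _ ≤ 50000 / n := by
          rw [div_le_div_iff₀ hN' hn']
          nlinarith [pi_lt_d2, pi_pos]

/-- Jackson's estimate for de la Vallée-Poussin sums of even functions. -/
theorem exists_vpSum_sub_le {g : ℝ → 𝕜} (hg : Continuous g) (hp : Function.Periodic g (2 * π))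
    (he : ∀ r, g (-r) = g r) {m : ℕ} {L : ℝ} (hL : 0 ≤ L) (h : DiffBound m L g) :
    ∃ C : ℝ, ∀ n : ℕ, 1 ≤ n → ∀ r : ℝ, ‖vpSum n g r - g r‖ ≤ C / (n : ℝ) ^ m := by
  refine ⟨4 * (50000 ^ m * L), fun n hn r => ?_⟩
  obtain ⟨J, hJ, h0, h1, h2⟩ := exists_jackson_kernel hn
  rw [vpSum_eq_periodicConv hg hp he]
  refine (norm_periodicConv_vpKernel_sub_le hn hJ h0 h1 hg hp h r).trans ?_
  have h3 : 0 ≤ ∫ t in (-π)..π, |t| * J t :=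
    integral_nonneg (by linarith [pi_pos]) fun t _ => mul_nonneg (abs_nonneg t) (h0 t)
  calc _ ≤ 4 * ((50000 / (n : ℝ)) ^ m * L) := by gcongr
    _ = _ := by rw [div_pow]; ring

end PeriodicConv

/-! ### From derivatives to difference bounds -/

section Lipschitz

variable {𝕜 : Type*} [RCLike 𝕜]

/-- A difference of step `t` turns the Lipschitz bound on the top derivative into a sup bound
`L|t|`, hence, by the mean value inequality, into a Lipschitz bound one order lower. -/
theorem DiffBound.of_hasDerivAt {G : ℕ → ℝ → 𝕜} {m : ℕ} {L : ℝ}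
    (hG : ∀ k < m, ∀ r, HasDerivAt (G k) (G (k + 1) r) r)
    (hL : ∀ x y, ‖G m x - G m y‖ ≤ L * |x - y|) : DiffBound (m + 1) L (G 0) := by
  induction m generalizing G L with
  | zero => exact fun t r => by simpa using hL (r + t) r
  | succ m ih =>
    intro t
    have hd : ∀ k < m + 1, ∀ r,
        HasDerivAt (fun r => G k (r + t) - G k r) (G (k + 1) (r + t) - G (k + 1) r) r :=
      fun k hk r => ((hG k hk (r + t)).comp_add_const r t).sub (hG k hk r)
    refine ih (G := fun k r => G k (r + t) - G k r) (fun k hk => hd k (by omega)) fun x y => ?_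
    have := convex_univ.norm_image_sub_le_of_norm_hasDerivWithin_le (C := L * |t|)
      (fun r _ => (hd m (by omega) r).hasDerivWithinAt)
      (fun r _ => by simpa using hL (r + t) r) (Set.mem_univ y) (Set.mem_univ x)
    simpa using this

theorem norm_sub_le_of_norm_deriv_le_off_countable {g : ℝ → 𝕜} (hg : Continuous g) {S : Set ℝ}
    (hS : S.Countable) (hd : ∀ x ∉ S, DifferentiableAt ℝ g x) {C : ℝ}
    (hC : ∀ x ∉ S, ‖deriv g x‖ ≤ C) (x y : ℝ) : ‖g x - g y‖ ≤ C * |x - y| := by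
  have hae : ∀ᵐ t : ℝ, ‖deriv g t‖ ≤ C := by
    filter_upwards [MeasureTheory.compl_mem_ae_iff.2 (hS.measure_zero _)] with t ht
    exact hC t ht
  have hint : IntervalIntegrable (deriv g) MeasureTheory.volume y x :=
    intervalIntegrable_const (c := C) |>.mono_fun' (stronglyMeasurable_deriv g).aestronglyMeasurable
      (MeasureTheory.ae_restrict_of_ae hae)
  rw [← MeasureTheory.integral_eq_of_hasDerivAt_off_countable g (deriv g) hS hg.continuousOn
    (fun t ht => (hd t ht.2).hasDerivAt) hint]
  exact intervalIntegral.norm_integral_le_of_norm_le_const_ae (hae.mono fun t ht _ => ht)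

theorem ContDiffAt.contDiffAt_iteratedDeriv {f : ℝ → 𝕜} {x : ℝ} {n m : WithTop ℕ∞} {k : ℕ}
    (h : ContDiffAt ℝ n f x) (hm : m + k ≤ n) : ContDiffAt ℝ m (iteratedDeriv k f) x := by
  rw [iteratedDeriv_eq_equiv_comp]
  exact (ContinuousMultilinearMap.piFieldEquiv ℝ (Fin k) 𝕜).symm.contDiff.contDiffAt.comp x
    (h.iteratedFDeriv_right hm)

end Lipschitz

/-! ### Regularity of the transformed kernel -/

noncomputable section Regularity

open Real Filter Asymptotics

variable {𝕜 : Type*} [RCLike 𝕜]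

/-- The decay handles large `x`; local boundedness and compactness handle `[0, M]`. -/
theorem exists_bound_iteratedDeriv {f : ℝ → 𝕜} {F a : ℝ} {η : ℕ}
    (hsmooth : ContDiffOn ℝ ∞ f (Set.Ici 0 \ {F}))
    (hjunction : ContDiffAt ℝ η f F)
    (hjunction_bdd : iteratedDeriv (η + 1) f =O[𝓝[≠] F] (fun _ => (1 : ℝ)))
    {k : ℕ} (hk : k ≤ η + 1) (hdecay : iteratedDeriv k f =O[atTop] fun x => exp (-(a * x))) :
    ∃ C : ℝ, 0 ≤ C ∧ ∀ x, 0 < x → x ≠ F → ‖iteratedDeriv k f x‖ ≤ C * exp (-(a * x)) := by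
  set V : Set ℝ := Set.Ioi 0 \ {F}
  have hloc : ∀ x₀, 0 ≤ x₀ → iteratedDeriv k f =O[𝓝[V] x₀] (fun _ => (1 : ℝ)) := by
    intro x₀ hx₀
    rcases eq_or_ne x₀ F with rfl | hne
    · have hVne : 𝓝[V] x₀ ≤ 𝓝[≠] x₀ := nhdsWithin_mono _ fun x hx => hx.2
      rcases Nat.lt_or_ge η k with hlt | hle
      · obtain rfl : k = η + 1 := by omega
        exact hjunction_bdd.mono hVne
      · have : ContDiffAt ℝ 0 (iteratedDeriv k f) x₀ :=
          hjunction.contDiffAt_iteratedDeriv (by rw [zero_add]; exact_mod_cast hle)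
        exact (this.continuousAt.tendsto.mono_left nhdsWithin_le_nhds).isBigO_one ℝ
    -- Nothing is known of `f` on the negative axis, so at `x₀ = 0` continuity comes from
    -- derivatives within the domain, which agree with the two-sided ones on `V`.
    · have hu : UniqueDiffOn ℝ (Set.Ici (0 : ℝ) \ {F}) :=
        (uniqueDiffOn_Ici 0).inter isOpen_compl_singleton
      have hc := (hsmooth.continuousOn_iteratedDerivWithin (m := k) (by exact_mod_cast le_top) hu)
        x₀ ⟨hx₀, hne⟩
      have hV : V ⊆ Set.Ici (0 : ℝ) \ {F} := fun x hx => ⟨Set.Ioi_subset_Ici_self hx.1, hx.2⟩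
      have hb := (hc.tendsto.mono_left (nhdsWithin_mono _ hV)).isBigO_one ℝ
      refine hb.congr' ?_ EventuallyEq.rfl
      filter_upwards [self_mem_nhdsWithin] with x hx
      refine iteratedDerivWithin_eq_iteratedDeriv (n := k) hu ?_ (hV hx)
      exact ((hsmooth x (hV hx)).contDiffAt (mem_of_superset
        ((isOpen_Ioi.sdiff isClosed_singleton).mem_nhds hx) hV)).of_le (by exact_mod_cast le_top)
  obtain ⟨C₁, hC₁⟩ := hdecay.bound
  obtain ⟨M, hM⟩ := eventually_atTop.1 hC₁
  have hcomp : ∃ C : ℝ, ∀ x ∈ Set.Icc 0 M, x ∈ V → ‖iteratedDeriv k f x‖ ≤ C := by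
    refine isCompact_Icc.induction_on
      (p := fun s => ∃ C : ℝ, ∀ x ∈ s, x ∈ V → ‖iteratedDeriv k f x‖ ≤ C)
      ⟨0, fun x hx => absurd hx (Set.notMem_empty x)⟩
      (fun s t hst ⟨C, hC⟩ => ⟨C, fun x hx => hC x (hst hx)⟩)
      (fun s t ⟨C, hC⟩ ⟨D, hD⟩ => ⟨max C D, fun x hx hV => ?_⟩) fun x hx => ?_
    · rcases hx with hx | hx
      · exact (hC x hx hV).trans (le_max_left _ _)
      · exact (hD x hx hV).trans (le_max_right _ _)
    · obtain ⟨C, hC⟩ := (hloc x hx.1).bound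
      refine ⟨_, mem_nhdsWithin_of_mem_nhds (eventually_nhdsWithin_iff.1 hC), C, fun y hy hV => ?_⟩
      simpa using hy hV
  obtain ⟨C₂, hC₂⟩ := hcomp
  have hC₂' : ∀ x ∈ Set.Icc 0 M, exp (-(|a| * M)) ≤ exp (-(a * x)) := by
    intro x hx
    rw [exp_le_exp, neg_le_neg_iff]
    exact (mul_le_mul_of_nonneg_right (le_abs_self a) hx.1).trans
      (mul_le_mul_of_nonneg_left hx.2 (abs_nonneg a))
  refine ⟨max |C₁| (|C₂| / exp (-(|a| * M))), le_max_of_le_left (abs_nonneg _),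
    fun x hx hxF => ?_⟩
  rcases le_total M x with h | h
  · refine (hM x h).trans ?_
    rw [norm_eq_abs, abs_exp]
    gcongr
    exact (le_abs_self _).trans (le_max_left _ _)
  · have hx' : x ∈ Set.Icc 0 M := ⟨hx.le, h⟩
    calc ‖iteratedDeriv k f x‖ ≤ |C₂| := (hC₂ x hx' ⟨hx, hxF⟩).trans (le_abs_self _)
      _ = |C₂| / exp (-(|a| * M)) * exp (-(|a| * M)) := by field_simp
      _ ≤ _ := mul_le_mul (le_max_right _ _) (hC₂' x hx') (exp_pos _).le
          (le_max_of_le_left (abs_nonneg _))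

/-- The change of variables `x = -n_c log ((1 + cos r) / 2)`. -/
def kernelArg (nc r : ℝ) : ℝ := -nc * log ((1 + cos r) / 2)

/-- The points at which `f ∘ kernelArg nc` is smooth and where `kernelArg nc` is positive. -/
def regularSet (nc F : ℝ) : Set ℝ := {r | sin r ≠ 0 ∧ cos r ≠ 2 * exp (-F / nc) - 1}

theorem isOpen_regularSet (nc F : ℝ) : IsOpen (regularSet nc F) :=
  (isOpen_ne_fun continuous_sin continuous_const).inter
    (isOpen_ne_fun continuous_cos continuous_const)

theorem countable_setOf_cos_eq (c : ℝ) : {r | cos r = c}.Countable := by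
  rcases Set.eq_empty_or_nonempty {r | cos r = c} with h | ⟨y, hy⟩
  · rw [h]; exact Set.countable_empty
  · refine ((Set.countable_range fun k : ℤ => 2 * k * π + y).union
      (Set.countable_range fun k : ℤ => 2 * k * π - y)).mono fun r hr => ?_
    obtain ⟨k, hk⟩ := cos_eq_cos_iff.1 (hy.trans (Eq.symm hr))
    exact hk.imp (fun h => ⟨k, h.symm⟩) fun h => ⟨k, h.symm⟩

theorem countable_compl_regularSet (nc F : ℝ) : (regularSet nc F)ᶜ.Countable := by
  refine (((countable_setOf_cos_eq 1).union (countable_setOf_cos_eq (-1))).union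
    (countable_setOf_cos_eq (2 * exp (-F / nc) - 1))).mono fun r hr => ?_
  by_cases h : sin r = 0
  · exact Or.inl (Real.sin_eq_zero_iff_cos_eq.1 h)
  · exact Or.inr (by_contra fun h' => hr ⟨h, h'⟩)

theorem one_add_cos_pos {r : ℝ} (h : cos r ≠ -1) : 0 < 1 + cos r := by
  have := lt_of_le_of_ne (neg_one_le_cos r) h.symm; linarith

theorem kernelArg_nonneg {nc : ℝ} (hnc : 0 < nc) {r : ℝ} (h : cos r ≠ -1) :
    0 ≤ kernelArg nc r := by
  have := one_add_cos_pos h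
  have h1 := log_nonpos (x := (1 + cos r) / 2) (by linarith) (by linarith [cos_le_one r])
  unfold kernelArg; nlinarith

theorem kernelArg_pos {nc : ℝ} (hnc : 0 < nc) {r : ℝ} (h : sin r ≠ 0) : 0 < kernelArg nc r := by
  rw [ne_eq, Real.sin_eq_zero_iff_cos_eq, not_or] at h
  have := one_add_cos_pos h.2
  have h2 := lt_of_le_of_ne (cos_le_one r) h.1
  have h1 := log_neg (x := (1 + cos r) / 2) (by linarith) (by linarith)
  unfold kernelArg; nlinarith

theorem cos_eq_of_kernelArg_eq {nc F : ℝ} (hnc : 0 < nc) {r : ℝ} (h : cos r ≠ -1)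
    (hF : kernelArg nc r = F) : cos r = 2 * exp (-F / nc) - 1 := by
  have h0 := one_add_cos_pos h
  have : -F / nc = log ((1 + cos r) / 2) := by
    rw [← hF, kernelArg]; field_simp
  rw [this, exp_log (by linarith)]; ring

theorem contDiffAt_kernelArg (nc : ℝ) {r : ℝ} (h : cos r ≠ -1) :
    ContDiffAt ℝ ∞ (kernelArg nc) r := by
  have := one_add_cos_pos h
  unfold kernelArg
  refine contDiffAt_const.mul (ContDiffAt.log ?_ (by positivity))
  fun_prop

theorem transformedKernel_eventuallyEq (nc : ℝ) (f : ℝ → 𝕜) {r : ℝ} (h : cos r ≠ -1) :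
    transformedKernel nc f =ᶠ[𝓝 r] f ∘ kernelArg nc := by
  filter_upwards [(isOpen_ne_fun continuous_cos continuous_const).mem_nhds h] with s hs
  simp [transformedKernel, kernelArg, show cos s ≠ -1 from hs]

/-- `kernelArg` never becomes negative, so one-sided smoothness of `f` at 0 is enough for smoothness
in `r`. -/
theorem contDiffAt_transformedKernel {f : ℝ → 𝕜} {nc F : ℝ} (hnc : 0 < nc)
    (hsmooth : ContDiffOn ℝ ∞ f (Set.Ici 0 \ {F})) {r : ℝ} (h : cos r ≠ -1)
    (hF : kernelArg nc r ≠ F) : ContDiffAt ℝ ∞ (transformedKernel nc f) r := by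
  refine ContDiffAt.congr_of_eventuallyEq ?_ (transformedKernel_eventuallyEq nc f h)
  have hk := contDiffAt_kernelArg nc h
  have hmem : kernelArg nc ⁻¹' (Set.Ici 0 \ {F}) ∈ 𝓝 r := by
    filter_upwards [(isOpen_ne_fun continuous_cos continuous_const).mem_nhds h,
      hk.continuousAt.eventually_ne hF] with s hs hsF
    exact ⟨kernelArg_nonneg hnc hs, hsF⟩
  exact ((hsmooth _ ⟨kernelArg_nonneg hnc h, hF⟩).comp r hk.contDiffWithinAt
    (Set.mapsTo_preimage _ _)).contDiffAt hmem

theorem contDiffAt_transformedKernel_nat {f : ℝ → 𝕜} {nc F : ℝ} {η : ℕ} (hnc : 0 < nc)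
    (hsmooth : ContDiffOn ℝ ∞ f (Set.Ici 0 \ {F})) (hjunction : ContDiffAt ℝ η f F)
    {r : ℝ} (h : cos r ≠ -1) : ContDiffAt ℝ η (transformedKernel nc f) r := by
  rcases eq_or_ne (kernelArg nc r) F with rfl | hF
  · exact (hjunction.comp r ((contDiffAt_kernelArg nc h).of_le
      (by exact_mod_cast le_top))).congr_of_eventuallyEq (transformedKernel_eventuallyEq nc f h)
  · exact (contDiffAt_transformedKernel hnc hsmooth h hF).of_le (by exact_mod_cast le_top)

theorem cos_half_ne_zero {r : ℝ} (h : cos r ≠ -1) : cos (r / 2) ≠ 0 := by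
  intro h0
  have := cos_sq (r / 2)
  rw [h0, mul_div_cancel₀ r two_ne_zero] at this
  exact h (by linarith)

theorem exp_neg_kernelArg {nc : ℝ} (hnc : 0 < nc) (m : ℕ) {r : ℝ} (h : cos r ≠ -1) :
    exp (-((m / (2 * nc)) * kernelArg nc r)) = |cos (r / 2)| ^ m := by
  have h0 : (1 + cos r) / 2 = |cos (r / 2)| ^ 2 := by
    rw [sq_abs, cos_sq, mul_div_cancel₀ r two_ne_zero]; ring
  have hp : 0 < |cos (r / 2)| := abs_pos.2 (cos_half_ne_zero h)
  rw [kernelArg, h0, log_pow, ← exp_log (pow_pos hp m), log_pow]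
  congr 1
  push_cast; field_simp

theorem hasDerivAt_tan_half {r : ℝ} (h : cos r ≠ -1) :
    HasDerivAt (fun r => tan (r / 2)) ((1 + tan (r / 2) ^ 2) / 2) r := by
  have h0 := cos_half_ne_zero h
  refine ((hasDerivAt_tan h0).comp r ((hasDerivAt_id r).div_const 2)).congr_deriv ?_
  rw [tan_eq_sin_div_cos]
  field_simp
  linarith [sin_sq_add_cos_sq (r / 2)]

theorem hasDerivAt_kernelArg (nc : ℝ) {r : ℝ} (h : cos r ≠ -1) :
    HasDerivAt (kernelArg nc) (nc * tan (r / 2)) r := by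
  have h0 := cos_half_ne_zero h
  have hpos := one_add_cos_pos h
  refine (((((hasDerivAt_cos r).const_add 1).div_const 2).log
    (by positivity)).const_mul (-nc)).congr_deriv ?_
  have hc : cos r = 2 * cos (r / 2) ^ 2 - 1 := by
    rw [← cos_two_mul, mul_div_cancel₀ r two_ne_zero]
  have hs : sin r = 2 * sin (r / 2) * cos (r / 2) := by
    rw [← sin_two_mul, mul_div_cancel₀ r two_ne_zero]
  rw [tan_eq_sin_div_cos, hs, hc]
  field_simp
  ring

/-- With `T = tan (r/2)`, `T' = (1 + T²)/2` and `x' = n_c T`, so differentiating raises the degree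
in `T` by at most one. The vanishing of `p k` for `k > m` lets the induction lengthen the sum. -/
theorem exists_iteratedDeriv_transformedKernel_eq {f : ℝ → 𝕜} {nc F : ℝ} (hnc : 0 < nc)
    (hsmooth : ContDiffOn ℝ ∞ f (Set.Ici 0 \ {F})) (m : ℕ) :
    ∃ p : ℕ → Polynomial ℝ, (∀ k, (p k).natDegree ≤ m) ∧ (∀ k, m < k → p k = 0) ∧
      ∀ r ∈ regularSet nc F, iteratedDeriv m (transformedKernel nc f) r
        = ∑ k ∈ Finset.range (m + 1),
          (p k).eval (tan (r / 2)) • iteratedDeriv k f (kernelArg nc r) := by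
  induction m with
  | zero =>
    refine ⟨fun k => if k = 0 then 1 else 0, fun k => ?_, fun k hk => if_neg (by omega), ?_⟩
    · by_cases hk : k = 0 <;> simp [hk]
    · intro r hr
      have h : cos r ≠ -1 := fun h => hr.1 (Real.sin_eq_zero_iff_cos_eq.2 (Or.inr h))
      simpa using (transformedKernel_eventuallyEq nc f h).eq_of_nhds
  | succ m ih =>
    obtain ⟨p, hdeg, hzero, hp⟩ := ih
    refine ⟨fun k => (p k).derivative * (Polynomial.C (1 / 2) * (1 + Polynomial.X ^ 2))
      + Polynomial.C nc * Polynomial.X * (if k = 0 then 0 else p (k - 1)), fun k => ?_,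
      fun k hk => ?_, fun r hr => ?_⟩
    · refine Polynomial.natDegree_add_le_of_degree_le ?_ ?_
      · rcases Nat.eq_zero_or_pos (p k).natDegree with h0 | h0
        · rw [Polynomial.derivative_of_natDegree_zero h0]; simp
        · have h1 := Polynomial.natDegree_derivative_lt h0.ne'
          have h2 : (Polynomial.C (1 / 2 : ℝ) * (1 + Polynomial.X ^ 2)).natDegree ≤ 2 := by
            compute_degree
          have := hdeg k
          exact Polynomial.natDegree_mul_le.trans (by omega)
      · have h2 : (Polynomial.C nc * Polynomial.X).natDegree ≤ 1 := by compute_degree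
        have h3 : (if k = 0 then (0 : Polynomial ℝ) else p (k - 1)).natDegree ≤ m := by
          split_ifs
          · simp
          · exact hdeg _
        exact Polynomial.natDegree_mul_le.trans (by omega)
    · simp only []
      rw [hzero k (by omega), if_neg (by omega), hzero (k - 1) (by omega)]; simp
    · have h : cos r ≠ -1 := fun h => hr.1 (Real.sin_eq_zero_iff_cos_eq.2 (Or.inr h))
      have hF : kernelArg nc r ≠ F := fun hF => hr.2 (cos_eq_of_kernelArg_eq hnc h hF)
      have hpos := kernelArg_pos hnc hr.1
      have hf : ∀ k, HasDerivAt (iteratedDeriv k f) (iteratedDeriv (k + 1) f (kernelArg nc r))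
          (kernelArg nc r) := by
        intro k
        have h1 : ContDiffAt ℝ ∞ f (kernelArg nc r) :=
          (hsmooth _ ⟨hpos.le, hF⟩).contDiffAt (mem_of_superset
            ((isOpen_Ioi.sdiff isClosed_singleton).mem_nhds ⟨hpos, hF⟩)
            fun x hx => ⟨Set.Ioi_subset_Ici_self hx.1, hx.2⟩)
        have h2 : ContDiffAt ℝ 1 (iteratedDeriv k f) (kernelArg nc r) :=
          h1.contDiffAt_iteratedDeriv (by exact_mod_cast le_top)
        rw [iteratedDeriv_succ]
        exact (h2.differentiableAt one_ne_zero).hasDerivAt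
      rw [iteratedDeriv_succ]
      have hev : iteratedDeriv m (transformedKernel nc f) =ᶠ[𝓝 r]
          fun r => ∑ k ∈ Finset.range (m + 1),
            (p k).eval (tan (r / 2)) • iteratedDeriv k f (kernelArg nc r) := by
        filter_upwards [(isOpen_regularSet nc F).mem_nhds hr] with s hs using hp s hs
      rw [hev.deriv_eq]
      have hterm : ∀ k, HasDerivAt
          (fun r => (p k).eval (tan (r / 2)) • iteratedDeriv k f (kernelArg nc r))
          ((p k).eval (tan (r / 2)) • (nc * tan (r / 2)) •
              iteratedDeriv (k + 1) f (kernelArg nc r)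
            + ((p k).derivative.eval (tan (r / 2)) * ((1 + tan (r / 2) ^ 2) / 2)) •
              iteratedDeriv k f (kernelArg nc r)) r := by
        intro k
        exact (((p k).hasDerivAt _).comp r (hasDerivAt_tan_half h)).smul
          ((hf k).scomp r (hasDerivAt_kernelArg nc h))
      rw [(HasDerivAt.fun_sum fun k _ => hterm k).deriv, Finset.sum_add_distrib]
      simp only [Polynomial.eval_add, Polynomial.eval_mul, add_smul, Finset.sum_add_distrib]
      rw [add_comm]
      congr 1
      · rw [Finset.sum_range_succ _ (m + 1), hzero (m + 1) (by omega)]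
        simp only [Polynomial.derivative_zero, Polynomial.eval_zero, zero_mul, zero_smul, add_zero]
        refine Finset.sum_congr rfl fun k _ => ?_
        congr 1
        simp; left; ring
      · rw [Finset.sum_range_succ' _ (m + 1)]
        simp only [if_true, Polynomial.eval_zero, mul_zero, zero_smul, add_zero]
        refine Finset.sum_congr rfl fun k _ => ?_
        rw [if_neg (by omega), Nat.add_sub_cancel, smul_smul]
        congr 1
        simp; ring

/-- Used with `T = tan (r/2)` and `e = |cos (r/2)|`: each power of `T` costs one power of `e`. -/
theorem abs_eval_mul_pow_le {p : Polynomial ℝ} {m N : ℕ} (hp : p.natDegree ≤ m) (hm : m ≤ N)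
    {T e : ℝ} (he0 : 0 ≤ e) (he1 : e ≤ 1) (hT : |T| * e ≤ 1) :
    |p.eval T| * e ^ N ≤ (∑ i ∈ Finset.range (m + 1), |p.coeff i|) * e ^ (N - m) := by
  rw [Polynomial.eval_eq_sum_range' (Nat.lt_succ_of_le hp)]
  refine (mul_le_mul_of_nonneg_right (Finset.abs_sum_le_sum_abs _ _) (by positivity)).trans ?_
  rw [Finset.sum_mul, Finset.sum_mul]
  refine Finset.sum_le_sum fun i hi => ?_
  have hi := Finset.mem_range.1 hi
  rw [abs_mul, abs_pow, mul_assoc]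
  gcongr
  calc |T| ^ i * e ^ N = (|T| * e) ^ i * e ^ (N - i) := by
        rw [mul_pow, mul_assoc, ← pow_add]; congr 2; omega
    _ ≤ 1 * e ^ (N - m) := by
        gcongr ?_ * ?_
        · exact pow_le_one₀ (by positivity) hT
        · exact pow_le_pow_of_le_one he0 he1 (by omega)
    _ = _ := one_mul _

theorem exists_bound_iteratedDeriv_transformedKernel {f : ℝ → 𝕜} {nc F : ℝ} {η : ℕ}
    (hnc : 0 < nc) (hsmooth : ContDiffOn ℝ ∞ f (Set.Ici 0 \ {F}))
    (hjunction : ContDiffAt ℝ η f F)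
    (hjunction_bdd : iteratedDeriv (η + 1) f =O[𝓝[≠] F] (fun _ => (1 : ℝ)))
    (hdecay : ∀ k ≤ η + 1, iteratedDeriv k f =O[atTop]
      (fun x => exp (-(((η : ℝ) + 1) * x / (2 * nc))))) {m : ℕ} (hm : m ≤ η + 1) :
    ∃ C : ℝ, 0 ≤ C ∧ ∀ r ∈ regularSet nc F,
      ‖iteratedDeriv m (transformedKernel nc f) r‖ ≤ C * |cos (r / 2)| ^ (η + 1 - m) := by
  have hb : ∀ k : ℕ, ∃ C : ℝ, 0 ≤ C ∧ (k ≤ η + 1 → ∀ x, 0 < x → x ≠ F →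
      ‖iteratedDeriv k f x‖ ≤ C * exp (-((((η + 1 : ℕ) : ℝ) / (2 * nc)) * x))) := by
    intro k
    by_cases hk : k ≤ η + 1
    · obtain ⟨C, hC0, hC⟩ := exists_bound_iteratedDeriv (a := ((η + 1 : ℕ) : ℝ) / (2 * nc))
        hsmooth hjunction hjunction_bdd hk
        ((hdecay k hk).congr_right fun x => by push_cast; ring_nf)
      exact ⟨C, hC0, fun _ => hC⟩
    · exact ⟨0, le_rfl, fun h => absurd h hk⟩
  choose C hC0 hC using hb
  obtain ⟨p, hdeg, -, hp⟩ := exists_iteratedDeriv_transformedKernel_eq hnc hsmooth m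
  refine ⟨∑ k ∈ Finset.range (m + 1), C k * ∑ i ∈ Finset.range (m + 1), |(p k).coeff i|,
    Finset.sum_nonneg fun k _ => mul_nonneg (hC0 k) (Finset.sum_nonneg fun i _ => abs_nonneg _),
    fun r hr => ?_⟩
  have h : cos r ≠ -1 := fun h => hr.1 (Real.sin_eq_zero_iff_cos_eq.2 (Or.inr h))
  have hF : kernelArg nc r ≠ F := fun hF => hr.2 (cos_eq_of_kernelArg_eq hnc h hF)
  rw [hp r hr, Finset.sum_mul]
  refine (norm_sum_le _ _).trans (Finset.sum_le_sum fun k hk => ?_)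
  have hk := Finset.mem_range.1 hk
  have h1 := hC k (by omega) _ (kernelArg_pos hnc hr.1) hF
  rw [exp_neg_kernelArg hnc _ h] at h1
  have hT : |tan (r / 2)| * |cos (r / 2)| ≤ 1 := by
    rw [← abs_mul, tan_mul_cos (cos_half_ne_zero h)]; exact abs_sin_le_one _
  rw [norm_smul, norm_eq_abs]
  calc |(p k).eval (tan (r / 2))| * ‖iteratedDeriv k f (kernelArg nc r)‖
      ≤ |(p k).eval (tan (r / 2))| * (C k * |cos (r / 2)| ^ (η + 1)) := by gcongr
    _ = C k * (|(p k).eval (tan (r / 2))| * |cos (r / 2)| ^ (η + 1)) := by ring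
    _ ≤ C k * ((∑ i ∈ Finset.range (m + 1), |(p k).coeff i|) * |cos (r / 2)| ^ (η + 1 - m)) :=
        mul_le_mul_of_nonneg_left (abs_eval_mul_pow_le (hdeg k) hm (abs_nonneg _)
          (abs_cos_le_one _) hT) (hC0 k)
    _ = _ := by ring

theorem abs_cos_half_le {r₀ r : ℝ} (h : cos r₀ = -1) : |cos (r / 2)| ≤ |r - r₀| := by
  have hs : sin r₀ = 0 := Real.sin_eq_zero_iff_cos_eq.2 (Or.inr h)
  have h1 : cos r = -cos (r - r₀) := by
    rw [cos_sub, h, hs]; ring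
  rw [← sq_le_sq, cos_sq, mul_div_cancel₀ r two_ne_zero, h1]
  have := one_sub_sq_div_two_le_cos (x := r - r₀)
  nlinarith [sq_nonneg (r - r₀)]

theorem regularSet_mem_nhdsNE {nc F r₀ : ℝ} (h : cos r₀ = -1) : regularSet nc F ∈ 𝓝[≠] r₀ := by
  have h1 : ∀ᶠ r in 𝓝 r₀, cos r < 2 * exp (-F / nc) - 1 ∧ cos r < 1 := by
    refine continuous_cos.continuousAt.eventually
      (p := fun c => c < 2 * exp (-F / nc) - 1 ∧ c < 1) ?_
    rw [h]
    exact (eventually_lt_nhds (by linarith [exp_pos (-F / nc)])).and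
      (eventually_lt_nhds (by norm_num))
  have h2 : ∀ᶠ r in 𝓝[≠] r₀, cos r ≠ -1 := by
    have hball : Set.Ioo (r₀ - 1) (r₀ + 1) ∈ 𝓝[≠] r₀ :=
      mem_nhdsWithin_of_mem_nhds (Ioo_mem_nhds (by linarith) (by linarith))
    filter_upwards [hball, self_mem_nhdsWithin] with r hr hne hc
    have hs : sin r₀ = 0 := Real.sin_eq_zero_iff_cos_eq.2 (Or.inr h)
    have h3 : cos (r - r₀) = 1 := by rw [cos_sub, h, hs, hc]; ring
    have h4 := (cos_eq_one_iff_of_lt_of_lt (by linarith [hr.1, pi_gt_three])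
      (by linarith [hr.2, pi_gt_three])).1 h3
    exact hne (sub_eq_zero.1 h4)
  filter_upwards [mem_nhdsWithin_of_mem_nhds h1, h2] with r hr hr2
  refine ⟨fun hs => ?_, hr.1.ne⟩
  rcases Real.sin_eq_zero_iff_cos_eq.1 hs with h | h
  · exact hr.2.ne h
  · exact hr2 h

theorem hasDerivAt_zero_of_eventually_le {g : ℝ → 𝕜} {x₀ C : ℝ} (h0 : g x₀ = 0)
    (h : ∀ᶠ x in 𝓝[≠] x₀, ‖g x‖ ≤ C * |x - x₀| ^ 2) : HasDerivAt g 0 x₀ := by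
  have hO : g =O[𝓝 x₀] fun x => ‖x - x₀‖ ^ 2 := by
    refine IsBigO.of_bound C ?_
    filter_upwards [eventually_nhdsWithin_iff.1 h] with x hx
    rcases eq_or_ne x x₀ with rfl | hne
    · simp [h0]
    · simpa using hx hne
  rw [hasDerivAt_iff_isLittleO]
  simp only [h0, sub_zero, smul_zero]
  refine hO.trans_isLittleO ?_
  exact isLittleO_pow_sub_sub x₀ one_lt_two

theorem continuousAt_zero_of_eventually_le {g : ℝ → 𝕜} {x₀ C : ℝ} (h0 : g x₀ = 0)
    (h : ∀ᶠ x in 𝓝[≠] x₀, ‖g x‖ ≤ C * |x - x₀|) : ContinuousAt g x₀ := by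
  rw [ContinuousAt, h0]
  refine squeeze_zero_norm' (a := fun x => C * |x - x₀|) ?_ ?_
  · filter_upwards [eventually_nhdsWithin_iff.1 h] with x hx
    rcases eq_or_ne x x₀ with rfl | hne
    · simp [h0]
    · exact hx hne
  · have : ContinuousAt (fun x => C * |x - x₀|) x₀ := by fun_prop
    simpa [ContinuousAt] using this

theorem diffBound_transformedKernel {f : ℝ → 𝕜} {nc F : ℝ} {η : ℕ}
    (hnc : 0 < nc) (hsmooth : ContDiffOn ℝ ∞ f (Set.Ici 0 \ {F}))
    (hjunction : ContDiffAt ℝ η f F)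
    (hjunction_bdd : iteratedDeriv (η + 1) f =O[𝓝[≠] F] (fun _ => (1 : ℝ)))
    (hdecay : ∀ k ≤ η + 1, iteratedDeriv k f =O[atTop]
      (fun x => exp (-(((η : ℝ) + 1) * x / (2 * nc))))) :
    Continuous (transformedKernel nc f) ∧
      ∃ L, 0 ≤ L ∧ DiffBound (η + 1) L (transformedKernel nc f) := by
  set K := transformedKernel nc f with hK
  have hbound : ∀ m ≤ η + 1, ∃ C : ℝ, 0 ≤ C ∧ ∀ r ∈ regularSet nc F,
      ‖iteratedDeriv m K r‖ ≤ C * |cos (r / 2)| ^ (η + 1 - m) := fun m hm =>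
    exists_bound_iteratedDeriv_transformedKernel hnc hsmooth hjunction hjunction_bdd hdecay hm
  -- The limit defining `K` at odd multiples of `π` is 0, which starts the induction in `hzero`.
  have hlim : Tendsto f atTop (𝓝 0) := by
    have h := hdecay 0 (Nat.zero_le _)
    rw [iteratedDeriv_zero] at h
    refine h.trans_tendsto (tendsto_exp_neg_atTop_nhds_zero.comp ?_)
    have : Tendsto (fun x : ℝ => ((η : ℝ) + 1) / (2 * nc) * x) atTop atTop :=
      tendsto_id.const_mul_atTop (by positivity)
    refine this.congr fun x => by ring
  have hstep : ∀ m < η, ∀ r₀, cos r₀ = -1 → iteratedDeriv m K r₀ = 0 →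
      HasDerivAt (iteratedDeriv m K) 0 r₀ := by
    intro m hm r₀ hr₀ h0
    obtain ⟨C, hC0, hC⟩ := hbound m (by omega)
    refine hasDerivAt_zero_of_eventually_le (C := C) h0 ?_
    filter_upwards [regularSet_mem_nhdsNE hr₀] with r hr
    refine (hC r hr).trans ?_
    gcongr
    -- `m < η` leaves an exponent of at least 2, hence a zero derivative; for `m = η` the exponent 1
    -- gives only continuity.
    calc |cos (r / 2)| ^ (η + 1 - m) ≤ |cos (r / 2)| ^ 2 :=
          pow_le_pow_of_le_one (abs_nonneg _) (abs_cos_le_one _) (by omega)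
      _ ≤ _ := pow_le_pow_left₀ (abs_nonneg _) (abs_cos_half_le hr₀) 2
  have hzero : ∀ m ≤ η, ∀ r₀, cos r₀ = -1 → iteratedDeriv m K r₀ = 0 := by
    intro m
    induction m with
    | zero =>
      intro _ r₀ hr₀
      simp [hK, transformedKernel, hr₀, hlim.limUnder_eq]
    | succ m ih =>
      intro hm r₀ hr₀
      rw [iteratedDeriv_succ]
      exact (hstep m hm r₀ hr₀ (ih (by omega) r₀ hr₀)).deriv
  have hder : ∀ m < η, ∀ r, HasDerivAt (iteratedDeriv m K) (iteratedDeriv (m + 1) K r) r := by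
    intro m hm r
    rw [iteratedDeriv_succ]
    refine DifferentiableAt.hasDerivAt ?_
    by_cases hr : cos r = -1
    · exact (hstep m hm r hr (hzero m hm.le r hr)).differentiableAt
    · have h1 : ContDiffAt ℝ 1 (iteratedDeriv m K) r :=
        (contDiffAt_transformedKernel_nat hnc hsmooth hjunction hr).contDiffAt_iteratedDeriv
          (by exact_mod_cast (by omega : 1 + m ≤ η))
      exact h1.differentiableAt one_ne_zero
  have hcont : Continuous (iteratedDeriv η K) := by
    rw [continuous_iff_continuousAt]
    intro r
    by_cases hr : cos r = -1
    · obtain ⟨C, hC0, hC⟩ := hbound η (by omega)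
      refine continuousAt_zero_of_eventually_le (C := C) (hzero η le_rfl r hr) ?_
      filter_upwards [regularSet_mem_nhdsNE hr] with s hs
      have hs' := hC s hs
      rw [Nat.add_sub_cancel_left, pow_one] at hs'
      exact hs'.trans (mul_le_mul_of_nonneg_left (abs_cos_half_le hr) hC0)
    · have h1 : ContDiffAt ℝ 0 (iteratedDeriv η K) r :=
        (contDiffAt_transformedKernel_nat hnc hsmooth hjunction hr).contDiffAt_iteratedDeriv
          (by rw [zero_add])
      exact h1.continuousAt
  refine ⟨?_, ?_⟩
  · rcases Nat.eq_zero_or_pos η with h0 | h0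
    · subst h0; simpa using hcont
    · have : Differentiable ℝ (iteratedDeriv 0 K) := fun r => (hder 0 h0 r).differentiableAt
      simpa using this.continuous
  · obtain ⟨C, hC0, hC⟩ := hbound (η + 1) le_rfl
    refine ⟨C, hC0, ?_⟩
    -- At order `η + 1` the exponent is 0: a plain bound off a countable set, which with continuity
    -- makes the `η`-th derivative Lipschitz.
    have := DiffBound.of_hasDerivAt (G := fun m => iteratedDeriv m K) hder
      (norm_sub_le_of_norm_deriv_le_off_countable hcont (countable_compl_regularSet nc F)
        (C := C) (fun r hr => ?_) fun r hr => ?_)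
    · simpa using this
    · rw [Set.notMem_compl_iff] at hr
      have h : cos r ≠ -1 := fun h => hr.1 (Real.sin_eq_zero_iff_cos_eq.2 (Or.inr h))
      have h1 : ContDiffAt ℝ 1 (iteratedDeriv η K) r :=
        (contDiffAt_transformedKernel hnc hsmooth h
          fun hF => hr.2 (cos_eq_of_kernelArg_eq hnc h hF)).contDiffAt_iteratedDeriv
          (by exact_mod_cast le_top)
      exact h1.differentiableAt one_ne_zero
    · rw [← iteratedDeriv_succ]
      simpa using hC r (Set.notMem_compl_iff.1 hr)

end Regularity

theorem mainTheorem2 {𝕜 : Type*} [RCLike 𝕜] (f : ℝ → 𝕜) (nc F : ℝ) (η : ℕ)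
    (hnc : 0 < nc) (hF : 0 < F)
    (hsmooth : ContDiffOn ℝ ∞ f (Set.Ici 0 \ {F}))
    (hjunction : ContDiffAt ℝ η f F)
    (hjunction_bdd : iteratedDeriv (η + 1) f =O[𝓝[≠] F] (fun _ => (1 : ℝ)))
    (hdecay : ∀ k ≤ η + 1, iteratedDeriv k f =O[Filter.atTop]
      (fun x => Real.exp (-(((η : ℝ) + 1) * x / (2 * nc))))) :
    ∃ C : ℝ, ∀ n : ℕ, 1 ≤ n → ∀ r : ℝ,
      ‖vpSum n (transformedKernel nc f) r - transformedKernel nc f r‖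
        ≤ C / (n : ℝ) ^ (η + 1) := by
  obtain ⟨hcont, L, hL, hdiff⟩ :=
    diffBound_transformedKernel hnc hsmooth hjunction hjunction_bdd hdecay
  exact exists_vpSum_sub_le hcont (transformedKernel_periodic nc f) (transformedKernel_neg nc f)
    hL hdiff
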